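/- Let $(V,\bar g)$ be a non-empty smooth Riemannian $3$-manifold (without boundary) of constant sectional curvature $K$, let $J\subset\mathbb R$ be an open interval and let $b:J\to(0,\infty)$ be smooth. Consider on $J\times V$ the Robertson–Walker (Lorentzian) metric $$g=b(s)^2\,(-ds^2+\bar g).$$ Suppose that $(J\times V,g)$ is filled with pressureless dust of mass density $\rho$ and velocity field $u$, i.e. $\rho$ is a real function and $u$ a vector field on $J\times V$ with $g(u,u)=-1$, and that Einstein's equation holds on $J\times V$ with a constant $\Lambda\in\mathbb R$: $$\mathrm{Ric}-\tfrac12 R\,g=8\pi\tau-\Lambda g,\qquad \tau(v,w)=\rho\,g(u,v)\,g(u,w),$$ where $\mathrm{Ric}$ and $R$ are the Ricci and scalar curvatures of $g$. Then there is a constant $c\in\mathbb R$ such that $\rho(s,x)=c/b(s)^3$ for all $(s,x)\in J\times V$, and on $J$ $$b''+Kb-\tfrac23\Lambda b^3=\tfrac43\pi c,\qquad 3(b')^2b^{-1}+3Kb-\Lambda b^3=8\pi c.$$ -/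

import Mathlib

open scoped Manifold ContDiff

set_option maxSynthPendingDepth 3

noncomputable section

namespace RobertsonWalker

/-! ### Curvature of a (pseudo-)Riemannian metric on an open subset of a vector space

`G y` is the scalar product at the point `y`, for instance the expression of a metric in a chart. -/

section Coordinates

variable {E : Type*} [NormedAddCommGroup E] [NormedSpace ℝ E]

/-- Christoffel symbols of the first kind, as a trilinear form:
`koszul G y v w z = (∂_v G(w,z) + ∂_w G(v,z) - ∂_z G(v,w)) / 2`. -/
def koszul (G : E → E →L[ℝ] E →L[ℝ] ℝ) (y : E) : E →L[ℝ] E →L[ℝ] E →L[ℝ] ℝ :=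
  let D : E →L[ℝ] E →L[ℝ] E →L[ℝ] ℝ := fderiv ℝ G y
  let F : (E →L[ℝ] E →L[ℝ] ℝ) →L[ℝ] E →L[ℝ] E →L[ℝ] ℝ :=
    (ContinuousLinearMap.flipₗᵢ ℝ E E ℝ).toContinuousLinearEquiv.toContinuousLinearMap
  (1 / 2 : ℝ) • (D + D.flip - F.comp D.flip)

theorem koszul_apply (G : E → E →L[ℝ] E →L[ℝ] ℝ) (y v w z : E) :
    koszul G y v w z =
      (fderiv ℝ G y v w z + fderiv ℝ G y w v z - fderiv ℝ G y z v w) / 2 := by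
  simp [koszul]; ring

/-- Christoffel symbols of the second kind, `Γ(v,w) = D_v w` for constant vector fields `v`, `w`:
where the metric is nondegenerate, `christoffel G y v w` is the vector `Γ` such that
`G y Γ z = koszul G y v w z` for all `z`. -/
def christoffel (G : E → E →L[ℝ] E →L[ℝ] ℝ) (y : E) : E →L[ℝ] E →L[ℝ] E :=
  (ContinuousLinearMap.compL ℝ E (E →L[ℝ] ℝ) E (G y).inverse).comp (koszul G y)

theorem christoffel_apply (G : E → E →L[ℝ] E →L[ℝ] ℝ) (y v w : E) :
    christoffel G y v w = (G y).inverse (koszul G y v w) := rfl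

/-- Curvature tensor `R(u,v)w = D_u D_v w - D_v D_u w - D_{[u,v]} w`, computed on constant vector
fields `u`, `v`, `w`. -/
def coordRiemann (G : E → E →L[ℝ] E →L[ℝ] ℝ) (y u v w : E) : E :=
  fderiv ℝ (christoffel G) y u v w - fderiv ℝ (christoffel G) y v u w
    + christoffel G y u (christoffel G y v w) - christoffel G y v (christoffel G y u w)

/-- The endomorphism `u ↦ R(u,v)w`. -/
def coordRiemannEnd (G : E → E →L[ℝ] E →L[ℝ] ℝ) (y v w : E) : E →ₗ[ℝ] E where
  toFun u := coordRiemann G y u v w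
  map_add' u u' := by simp [coordRiemann]; abel
  map_smul' a u := by simp [coordRiemann, smul_sub, smul_add]

/-- Ricci curvature: `Ric(v,w)` is the trace of `u ↦ R(u,v)w`. -/
def coordRicci (G : E → E →L[ℝ] E →L[ℝ] ℝ) (y : E) : E →ₗ[ℝ] E →ₗ[ℝ] ℝ :=
  LinearMap.mk₂ ℝ (fun v w ↦ LinearMap.trace ℝ E (coordRiemannEnd G y v w))
    (fun v v' w ↦ by
      rw [← map_add]; congr 1; ext u
      simp [coordRiemannEnd, coordRiemann]; abel)
    (fun a v w ↦ by
      rw [← map_smul]; congr 1; ext u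
      simp [coordRiemannEnd, coordRiemann, smul_sub, smul_add])
    (fun v w w' ↦ by
      rw [← map_add]; congr 1; ext u
      simp [coordRiemannEnd, coordRiemann]; abel)
    (fun a v w ↦ by
      rw [← map_smul]; congr 1; ext u
      simp [coordRiemannEnd, coordRiemann, smul_sub, smul_add])

/-- Scalar curvature: the trace of the Ricci curvature with respect to the metric, that is the
trace of the endomorphism `S` such that `G y (S v) w = Ric(v,w)`. -/
def coordScalar [FiniteDimensional ℝ E] (G : E → E →L[ℝ] E →L[ℝ] ℝ) (y : E) : ℝ :=
  LinearMap.trace ℝ E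
    (((G y).inverse : (E →L[ℝ] ℝ) →ₗ[ℝ] E)
      ∘ₗ (LinearMap.toContinuousLinearMap : (E →ₗ[ℝ] ℝ) ≃ₗ[ℝ] (E →L[ℝ] ℝ)).toLinearMap
      ∘ₗ coordRicci G y)

end Coordinates

/-! ### Curvature of a metric on a manifold without boundary -/

section Manifold

variable {E : Type*} [NormedAddCommGroup E] [NormedSpace ℝ E]
  {H : Type*} [TopologicalSpace H] (I : ModelWithCorners ℝ E H)
  {M : Type*} [TopologicalSpace M] [ChartedSpace H M]

/-- Fields of bilinear forms on the tangent spaces of `M`. -/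
abbrev BilinField (M : Type*) [TopologicalSpace M] [ChartedSpace H M] :=
  Π x : M, TangentSpace I x →L[ℝ] TangentSpace I x →L[ℝ] ℝ

/-- The expression of `g` in the chart at `p`: the pullback of `g` by the inverse of the chart. -/
def chartExpr (g : BilinField I M) (p : M) (y : E) : E →L[ℝ] E →L[ℝ] ℝ :=
  let A : E →L[ℝ] E := mfderiv 𝓘(ℝ, E) I (extChartAt I p).symm y
  let B : E →L[ℝ] E →L[ℝ] ℝ := g ((extChartAt I p).symm y)
  B.bilinearComp A A

theorem chartExpr_apply (g : BilinField I M) (p : M) (y v w : E) :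
    chartExpr I g p y v w =
      g ((extChartAt I p).symm y) (mfderiv 𝓘(ℝ, E) I (extChartAt I p).symm y v)
        (mfderiv 𝓘(ℝ, E) I (extChartAt I p).symm y w) := rfl

/-- The differential at `p` of the chart at `p`. -/
def chartDeriv (p : M) : TangentSpace I p →L[ℝ] E :=
  mfderiv I 𝓘(ℝ, E) (extChartAt I p) p

/-- The totally covariant curvature tensor at `p`: `riemann I g p u v w z = g(R(u,v)w, z)`. -/
def riemann (g : BilinField I M) (p : M) (u v w z : TangentSpace I p) : ℝ :=
  let y := extChartAt I p p
  let d := chartDeriv I p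
  chartExpr I g p y (coordRiemann (chartExpr I g p) y (d u) (d v) (d w)) (d z)

/-- The Ricci curvature at `p`. -/
def ricci (g : BilinField I M) (p : M) (v w : TangentSpace I p) : ℝ :=
  coordRicci (chartExpr I g p) (extChartAt I p p) (chartDeriv I p v) (chartDeriv I p w)

/-- The scalar curvature at `p`. -/
def scalarCurvature [FiniteDimensional ℝ E] (g : BilinField I M) (p : M) : ℝ :=
  coordScalar (chartExpr I g p) (extChartAt I p p)

/-- The sectional curvature of the plane spanned by linearly independent vectors `v`, `w`. -/
def sectionalCurvature (g : BilinField I M) (p : M) (v w : TangentSpace I p) : ℝ :=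
  riemann I g p v w w v / (g p v v * g p w w - g p v w ^ 2)

/-- All sectional curvatures of `g` are equal to `K`. -/
def HasConstantSectionalCurvature (g : BilinField I M) (K : ℝ) : Prop :=
  ∀ (p : M) (v w : TangentSpace I p), LinearIndependent ℝ ![v, w] →
    sectionalCurvature I g p v w = K

/-- Energy-momentum tensor at `p` of pressureless dust with mass density `ρ` and velocity field
`u`, in its twice covariant form `τ(v,w) = ρ g(u,v) g(u,w)`. -/
def dustTensor (g : BilinField I M) (ρ : M → ℝ) (u : Π x : M, TangentSpace I x) (p : M)
    (v w : TangentSpace I p) : ℝ :=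
  ρ p * g p (u p) v * g p (u p) w

/-- The Einstein equation `Ric - (1/2) R g = 8 π τ - Λ g` at the point `p`. -/
def EinsteinEquationAt [FiniteDimensional ℝ E] (g : BilinField I M) (Λ : ℝ)
    (τ : Π x : M, TangentSpace I x → TangentSpace I x → ℝ) (p : M) : Prop :=
  ∀ v w : TangentSpace I p,
    ricci I g p v w - 1 / 2 * scalarCurvature I g p * g p v w
      = 8 * Real.pi * τ p v w - Λ * g p v w

end Manifold

/-! ### Robertson–Walker metrics -/

section RW

/-- The model of `3`-dimensional manifolds without boundary. -/
abbrev E3 := EuclideanSpace ℝ (Fin 3)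

/-- The model with corners of `ℝ × V`, where `V` is a `3`-dimensional manifold. -/
abbrev I4 : ModelWithCorners ℝ (ℝ × E3) (ModelProd ℝ E3) := 𝓘(ℝ, ℝ).prod (𝓡 3)

variable {V : Type*} [TopologicalSpace V] [ChartedSpace E3 V]

/-- The differential at `p` of the first coordinate `s` of `ℝ × V`. -/
def ds (p : ℝ × V) : TangentSpace I4 p →L[ℝ] ℝ :=
  mfderiv I4 𝓘(ℝ, ℝ) (Prod.fst : ℝ × V → ℝ) p

/-- The differential at `p` of the projection of `ℝ × V` to `V`. -/
def dproj (p : ℝ × V) : TangentSpace I4 p →L[ℝ] TangentSpace (𝓡 3) p.2 :=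
  mfderiv I4 (𝓡 3) (Prod.snd : ℝ × V → V) p

/-- The field of bilinear forms `b(s)² (-ds² + ḡ)` on `ℝ × V`, where `s` is the first coordinate.
It is a Lorentzian metric on `J × V` for every open set `J` on which `b` is smooth and positive. -/
def rwMetric (gbar : BilinField (𝓡 3) V) (b : ℝ → ℝ) : BilinField I4 (ℝ × V) := fun p ↦
  let τ : ℝ × E3 →L[ℝ] ℝ := ds p
  let π : ℝ × E3 →L[ℝ] E3 := dproj p
  let G : E3 →L[ℝ] E3 →L[ℝ] ℝ := gbar p.2
  let h : ℝ × E3 →L[ℝ] ℝ × E3 →L[ℝ] ℝ :=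
    -(ContinuousLinearMap.mul ℝ ℝ).bilinearComp τ τ + G.bilinearComp π π
  (b p.1) ^ 2 • h

theorem rwMetric_apply (gbar : BilinField (𝓡 3) V) (b : ℝ → ℝ) (p : ℝ × V)
    (v w : TangentSpace I4 p) :
    rwMetric gbar b p v w =
      b p.1 ^ 2 * (-(ds p v * ds p w) + gbar p.2 (dproj p v) (dproj p w)) := rfl

end RW

end RobertsonWalker

end

namespace RobertsonWalker

/-! ### Generalities on metrics in coordinates -/

section Coordinates

variable {E : Type*} [NormedAddCommGroup E] [NormedSpace ℝ E]

/-! In a product chart the metric is b²(-dt² + h). With a = b'/b its curvature is explicit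
(`coordRiemann_warped`). Constant curvature K gives Ric(h) = 2Kh, so Ric = -3a' dt² + (a' + 2a² +
2K)h and R = 6(a' + a² + K)/b².

On the diagonal, Einstein's equation becomes (3(a² + K) - Λb²) v₀² - (2a' + a² + K - Λb²) h(v,v) =
8πρ b⁴ (-u₀v₀ + h(u,v))², where u and v inside h stand for spatial parts. The left side is isotropic
in space and the right side has rank at most one. A spatial v orthogonal to u gives the acceleration
equation 2a' + a² + K = Λb². The spatial part of u then gives ρ h(u,u) = 0, so dust is at rest
wherever ρ ≠ 0, and ∂_t gives the energy equation (`IsWarpedData.friedmann`).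

Finally F = 3b'²/b + 3Kb - Λb³ has zero derivative by the acceleration equation
(`exists_const_of_acceleration`), and F = 8πρb³ by the energy equation. Hence c = ρb³ is constant;
no separate conservation law is needed. -/

theorem fderiv_clm_apply₂ {D F F' F'' : Type*} [NormedAddCommGroup D] [NormedSpace ℝ D]
    [NormedAddCommGroup F] [NormedSpace ℝ F] [NormedAddCommGroup F'] [NormedSpace ℝ F']
    [NormedAddCommGroup F''] [NormedSpace ℝ F''] {f : D → F →L[ℝ] F' →L[ℝ] F''} {y : D}
    (hf : DifferentiableAt ℝ f y) (u : D) (v : F) (w : F') :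
    fderiv ℝ f y u v w = fderiv ℝ (fun q ↦ f q v w) y u := by
  have h := ((hf.hasFDerivAt.clm_apply (hasFDerivAt_const v y)).clm_apply
    (hasFDerivAt_const w y)).fderiv
  rw [h]
  simp

/-- E and its dual have equal dimension. Invertibility matters because `ContinuousLinearMap.inverse`
is zero by default. -/
theorem isInvertible_of_injective [FiniteDimensional ℝ E] {B : E →L[ℝ] E →L[ℝ] ℝ}
    (hB : Function.Injective B) : B.IsInvertible := by
  have hr : Module.finrank ℝ E = Module.finrank ℝ (E →L[ℝ] ℝ) := by
    rw [← (LinearMap.toContinuousLinearMap : (E →ₗ[ℝ] ℝ) ≃ₗ[ℝ] (E →L[ℝ] ℝ)).finrank_eq]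
    exact (Subspace.dual_finrank_eq (K := ℝ) (V := E)).symm
  refine ⟨(LinearEquiv.ofInjectiveOfFinrankEq (B : E →ₗ[ℝ] E →L[ℝ] ℝ) hB
    hr).toContinuousLinearEquiv, ?_⟩
  ext v w
  exact congrArg (fun f : E →L[ℝ] ℝ ↦ f w)
    (LinearMap.congr_fun (LinearEquiv.coe_ofInjectiveOfFinrankEq (B : E →ₗ[ℝ] E →L[ℝ] ℝ) hB hr) v)

theorem contDiffOn_clm_apply₂ [FiniteDimensional ℝ E] {D F : Type*} [NormedAddCommGroup D]
    [NormedSpace ℝ D] [NormedAddCommGroup F] [NormedSpace ℝ F] {n : WithTop ℕ∞}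
    {f : D → E →L[ℝ] E →L[ℝ] F} {s : Set D}
    (hf : ∀ v w, ContDiffOn ℝ n (fun y ↦ f y v w) s) : ContDiffOn ℝ n f s :=
  contDiffOn_clm_apply.2 fun v ↦ contDiffOn_clm_apply.2 fun w ↦ hf v w

/-- Christoffel symbols can thus be found by checking a candidate against the Koszul formula,
without inverting the metric. -/
theorem christoffel_eq_of_koszul {G : E → E →L[ℝ] E →L[ℝ] ℝ} {y v w x : E}
    (hG : (G y).IsInvertible) (hx : ∀ z, koszul G y v w z = G y x z) :
    christoffel G y v w = x := by
  rw [christoffel_apply, hG.inverse_apply_eq]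
  ext z
  exact hx z

theorem apply_christoffel {G : E → E →L[ℝ] E →L[ℝ] ℝ} {y : E} (hG : (G y).IsInvertible)
    (v w z : E) : G y (christoffel G y v w) z = koszul G y v w z := by
  have h := (hG.inverse_apply_eq (x := christoffel G y v w) (y := koszul G y v w)).1 rfl
  rw [← h]

theorem contDiffOn_koszul {G : E → E →L[ℝ] E →L[ℝ] ℝ} {s : Set E} (hs : IsOpen s)
    (hG : ContDiffOn ℝ ∞ G s) : ContDiffOn ℝ ∞ (koszul G) s := by
  have hD : ContDiffOn ℝ ∞ (fderiv ℝ G) s := hG.fderiv_of_isOpen hs (by simp)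
  have hF : ContDiffOn ℝ ∞ (fun y ↦ (fderiv ℝ G y).flip) s :=
    (ContinuousLinearMap.flipₗᵢ ℝ E E (E →L[ℝ] ℝ)).contDiff.comp_contDiffOn hD
  exact ((hD.add hF).sub ((contDiffOn_const (c :=
    ((ContinuousLinearMap.flipₗᵢ ℝ E E ℝ).toContinuousLinearEquiv.toContinuousLinearMap :
      (E →L[ℝ] E →L[ℝ] ℝ) →L[ℝ] E →L[ℝ] E →L[ℝ] ℝ))).clm_comp hF)).const_smul (1 / 2 : ℝ)

theorem contDiffOn_christoffel [CompleteSpace E] {G : E → E →L[ℝ] E →L[ℝ] ℝ} {s : Set E}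
    (hs : IsOpen s) (hG : ContDiffOn ℝ ∞ G s) (hinv : ∀ y ∈ s, (G y).IsInvertible) :
    ContDiffOn ℝ ∞ (christoffel G) s := by
  have h : ContDiffOn ℝ ∞ (fun y ↦ (G y).inverse) s := fun y hy ↦
    (ContinuousLinearMap.IsInvertible.contDiffAt_map_inverse (hinv y hy)).comp_contDiffWithinAt y
      (hG y hy)
  have h' : ContDiffOn ℝ ∞
      (fun y ↦ ContinuousLinearMap.compL ℝ E (E →L[ℝ] ℝ) E (G y).inverse) s :=
    (ContinuousLinearMap.compL ℝ E (E →L[ℝ] ℝ) E).contDiff.comp_contDiffOn h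
  exact h'.clm_comp (contDiffOn_koszul hs hG)

/-- Curvature depends only on the germ of the metric; the chart expression of a Robertson–Walker
metric is identified with a warped metric only near the point. -/
theorem coordRiemann_congr {G G' : E → E →L[ℝ] E →L[ℝ] ℝ} {y : E}
    (h : G =ᶠ[nhds y] G') : coordRiemann G y = coordRiemann G' y := by
  have hc : christoffel G =ᶠ[nhds y] christoffel G' := by
    filter_upwards [h, Filter.EventuallyEq.fderiv (𝕜 := ℝ) h] with q hq hq'
    simp only [christoffel, koszul, hq, hq']
  funext u v w
  simp only [coordRiemann, hc.fderiv_eq, hc.eq_of_nhds]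

theorem coordRicci_congr {G G' : E → E →L[ℝ] E →L[ℝ] ℝ} {y : E}
    (h : G =ᶠ[nhds y] G') : coordRicci G y = coordRicci G' y := by
  ext v w
  simp only [coordRicci, LinearMap.mk₂_apply]
  congr 1
  ext u
  simp only [coordRiemannEnd, coordRiemann_congr h]

theorem coordScalar_congr [FiniteDimensional ℝ E] {G G' : E → E →L[ℝ] E →L[ℝ] ℝ} {y : E}
    (h : G =ᶠ[nhds y] G') : coordScalar G y = coordScalar G' y := by
  rw [coordScalar, coordScalar, coordRicci_congr h, h.eq_of_nhds]

end Coordinates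

/-! ### The metric `b(t)² (-dt² + h)` on an open subset of `ℝ × E` -/

section Warped

variable {E : Type*} [NormedAddCommGroup E] [NormedSpace ℝ E]

/-- The metric `b(t)² (-dt² + h)` on `ℝ × E`. -/
noncomputable def warped (b : ℝ → ℝ) (h : E → E →L[ℝ] E →L[ℝ] ℝ) (p : ℝ × E) :
    ℝ × E →L[ℝ] ℝ × E →L[ℝ] ℝ :=
  b p.1 ^ 2 • (-(ContinuousLinearMap.mul ℝ ℝ).bilinearComp (ContinuousLinearMap.fst ℝ ℝ E)
      (ContinuousLinearMap.fst ℝ ℝ E)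
    + (h p.2).bilinearComp (ContinuousLinearMap.snd ℝ ℝ E) (ContinuousLinearMap.snd ℝ ℝ E))

theorem warped_apply (b : ℝ → ℝ) (h : E → E →L[ℝ] E →L[ℝ] ℝ) (p v w : ℝ × E) :
    warped b h p v w = b p.1 ^ 2 * (-(v.1 * w.1) + h p.2 v.2 w.2) := rfl

variable {b : ℝ → ℝ} {h : E → E →L[ℝ] E →L[ℝ] ℝ} {J : Set ℝ} {s : Set E}

theorem contDiffOn_warped [FiniteDimensional ℝ E] (hb : ContDiffOn ℝ ∞ b J)
    (hh : ContDiffOn ℝ ∞ h s) : ContDiffOn ℝ ∞ (warped b h) (J ×ˢ s) := by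
  refine contDiffOn_clm_apply₂ fun v w ↦ ?_
  have h1 : ContDiffOn ℝ ∞ (fun q : ℝ × E ↦ b q.1) (J ×ˢ s) :=
    hb.comp contDiffOn_fst fun q hq ↦ hq.1
  have h2 : ContDiffOn ℝ ∞ (fun q : ℝ × E ↦ h q.2) (J ×ˢ s) :=
    hh.comp contDiffOn_snd fun q hq ↦ hq.2
  exact (h1.pow 2).mul (contDiffOn_const.add
    ((h2.clm_apply contDiffOn_const).clm_apply contDiffOn_const))

theorem isInvertible_warped [FiniteDimensional ℝ E] {p : ℝ × E} (hb : b p.1 ≠ 0)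
    (hh : (h p.2).IsInvertible) :
    (warped b h p).IsInvertible := by
  refine isInvertible_of_injective ((injective_iff_map_eq_zero _).2 fun v hv ↦ ?_)
  have h0 : v.1 = 0 := by
    have := congrArg (fun f ↦ f (1, 0)) hv
    simpa [warped_apply, hb] using this
  have hinj : Function.Injective (h p.2) := by
    obtain ⟨e, he⟩ := hh
    rw [← he]
    exact e.injective
  refine Prod.ext h0 (hinj ?_)
  ext w
  have := congrArg (fun f ↦ f (0, w)) hv
  simpa [warped_apply, hb] using this

theorem fderiv_warped_apply {p : ℝ × E} (hb : DifferentiableAt ℝ b p.1)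
    (hh : DifferentiableAt ℝ h p.2) (hG : DifferentiableAt ℝ (warped b h) p) (u v w : ℝ × E) :
    fderiv ℝ (warped b h) p u v w =
      2 * b p.1 * deriv b p.1 * u.1 * (-(v.1 * w.1) + h p.2 v.2 w.2)
        + b p.1 ^ 2 * fderiv ℝ h p.2 u.2 v.2 w.2 := by
  rw [fderiv_clm_apply₂ hG]
  have h1 : HasFDerivAt (fun q : ℝ × E ↦ b q.1)
      (deriv b p.1 • ContinuousLinearMap.fst ℝ ℝ E) p :=
    hb.hasDerivAt.comp_hasFDerivAt p hasFDerivAt_fst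
  have h2 : HasFDerivAt (fun q : ℝ × E ↦ h q.2)
      ((fderiv ℝ h p.2).comp (ContinuousLinearMap.snd ℝ ℝ E)) p :=
    hh.hasFDerivAt.comp p hasFDerivAt_snd
  have h3 := (h1.pow 2).mul (((h2.clm_apply (hasFDerivAt_const v.2 p)).clm_apply
    (hasFDerivAt_const w.2 p)).const_add (-(v.1 * w.1)))
  have h4 : (fun q ↦ warped b h q v w) =
    (fun q : ℝ × E ↦ b q.1 ^ 2) * fun q ↦ -(v.1 * w.1) + h q.2 v.2 w.2 := rfl
  rw [h4, h3.fderiv]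
  simp
  ring

/-- The hypotheses on the factors of a warped metric on `J × s`. -/
structure IsWarpedData (b : ℝ → ℝ) (h : E → E →L[ℝ] E →L[ℝ] ℝ) (J : Set ℝ) (s : Set E) :
    Prop where
  isOpen_left : IsOpen J
  isOpen_right : IsOpen s
  contDiffOn_left : ContDiffOn ℝ ∞ b J
  contDiffOn_right : ContDiffOn ℝ ∞ h s
  ne_zero : ∀ t ∈ J, b t ≠ 0
  symm : ∀ y ∈ s, ∀ v w, h y v w = h y w v
  isInvertible : ∀ y ∈ s, (h y).IsInvertible

namespace IsWarpedData

variable (H : IsWarpedData b h J s) {p : ℝ × E}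
include H

theorem isOpen_prod : IsOpen (J ×ˢ s) := H.isOpen_left.prod H.isOpen_right

theorem differentiableAt_left (hp : p ∈ J ×ˢ s) : DifferentiableAt ℝ b p.1 :=
  (H.contDiffOn_left.contDiffAt (H.isOpen_left.mem_nhds hp.1)).differentiableAt (by simp)

theorem differentiableAt_right (hp : p ∈ J ×ˢ s) : DifferentiableAt ℝ h p.2 :=
  (H.contDiffOn_right.contDiffAt (H.isOpen_right.mem_nhds hp.2)).differentiableAt (by simp)

theorem differentiableAt_logDeriv (hp : p ∈ J ×ˢ s) :
    DifferentiableAt ℝ (fun t ↦ deriv b t / b t) p.1 := by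
  have h1 : DifferentiableAt ℝ (deriv b) p.1 :=
    ((H.contDiffOn_left.deriv_of_isOpen H.isOpen_left (m := ∞) (by simp)).contDiffAt
      (H.isOpen_left.mem_nhds hp.1)).differentiableAt (by simp)
  exact h1.div (H.differentiableAt_left hp) (H.ne_zero _ hp.1)

variable [FiniteDimensional ℝ E]

theorem contDiffOn : ContDiffOn ℝ ∞ (warped b h) (J ×ˢ s) :=
  contDiffOn_warped H.contDiffOn_left H.contDiffOn_right

theorem isInvertible_prod (hp : p ∈ J ×ˢ s) : (warped b h p).IsInvertible :=
  isInvertible_warped (H.ne_zero _ hp.1) (H.isInvertible _ hp.2)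

/-- The conformal factor b² adds df(v)w + df(w)v - ⟨v,w⟩ grad f, with f = log |b|, to the symbols of
the product metric -dt² + h. -/
theorem christoffel_warped (hp : p ∈ J ×ˢ s) (v w : ℝ × E) :
    christoffel (warped b h) p v w =
      (deriv b p.1 / b p.1 * (v.1 * w.1 + h p.2 v.2 w.2),
        (deriv b p.1 / b p.1) • (v.1 • w.2 + w.1 • v.2) + christoffel h p.2 v.2 w.2) := by
  refine christoffel_eq_of_koszul (H.isInvertible_prod hp) fun z ↦ ?_
  have hG : DifferentiableAt ℝ (warped b h) p :=
    (H.contDiffOn.contDiffAt (H.isOpen_prod.mem_nhds hp)).differentiableAt (by simp)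
  have hd := fderiv_warped_apply (H.differentiableAt_left hp) (H.differentiableAt_right hp) hG
  have hc := apply_christoffel (H.isInvertible _ hp.2) v.2 w.2 z.2
  have hb := H.ne_zero _ hp.1
  rw [koszul_apply, warped_apply, hd, hd, hd]
  simp only [map_add, map_smul, add_apply, smul_apply,
    smul_eq_mul, hc, koszul_apply]
  field_simp
  ring

theorem differentiableAt_christoffel_right (hp : p ∈ J ×ˢ s) :
    DifferentiableAt ℝ (christoffel h) p.2 :=
  haveI := FiniteDimensional.complete ℝ E
  ((contDiffOn_christoffel H.isOpen_right H.contDiffOn_right H.isInvertible).contDiffAt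
    (H.isOpen_right.mem_nhds hp.2)).differentiableAt (by simp)

theorem differentiableAt_christoffel (hp : p ∈ J ×ˢ s) :
    DifferentiableAt ℝ (christoffel (warped b h)) p :=
  haveI := FiniteDimensional.complete ℝ (ℝ × E)
  ((contDiffOn_christoffel H.isOpen_prod H.contDiffOn fun _ ↦ H.isInvertible_prod).contDiffAt
    (H.isOpen_prod.mem_nhds hp)).differentiableAt (by simp)

theorem fderiv_christoffel_warped (hp : p ∈ J ×ˢ s) (u v w : ℝ × E) :
    fderiv ℝ (christoffel (warped b h)) p u v w =
      (u.1 * deriv (fun t ↦ deriv b t / b t) p.1 * (v.1 * w.1 + h p.2 v.2 w.2)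
          + deriv b p.1 / b p.1 * fderiv ℝ h p.2 u.2 v.2 w.2,
        (u.1 * deriv (fun t ↦ deriv b t / b t) p.1) • (v.1 • w.2 + w.1 • v.2)
          + fderiv ℝ (christoffel h) p.2 u.2 v.2 w.2) := by
  rw [fderiv_clm_apply₂ (H.differentiableAt_christoffel hp)]
  have he : (fun q ↦ christoffel (warped b h) q v w) =ᶠ[nhds p] fun q ↦
      (deriv b q.1 / b q.1 * (v.1 * w.1 + h q.2 v.2 w.2),
        (deriv b q.1 / b q.1) • (v.1 • w.2 + w.1 • v.2) + christoffel h q.2 v.2 w.2) := by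
    filter_upwards [H.isOpen_prod.mem_nhds hp] with q hq
    exact H.christoffel_warped hq v w
  rw [he.fderiv_eq]
  have h1 : HasFDerivAt (fun q : ℝ × E ↦ deriv b q.1 / b q.1)
      (deriv (fun t ↦ deriv b t / b t) p.1 • ContinuousLinearMap.fst ℝ ℝ E) p :=
    (H.differentiableAt_logDeriv hp).hasDerivAt.comp_hasFDerivAt p hasFDerivAt_fst
  have h2 : HasFDerivAt (fun q : ℝ × E ↦ h q.2)
      ((fderiv ℝ h p.2).comp (ContinuousLinearMap.snd ℝ ℝ E)) p :=
    (H.differentiableAt_right hp).hasFDerivAt.comp p hasFDerivAt_snd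
  have h3 : HasFDerivAt (fun q : ℝ × E ↦ christoffel h q.2)
      ((fderiv ℝ (christoffel h) p.2).comp (ContinuousLinearMap.snd ℝ ℝ E)) p :=
    (H.differentiableAt_christoffel_right hp).hasFDerivAt.comp p hasFDerivAt_snd
  have h4 := h1.mul (((h2.clm_apply (hasFDerivAt_const v.2 p)).clm_apply
    (hasFDerivAt_const w.2 p)).const_add (v.1 * w.1))
  have h5 := (h1.smul_const (v.1 • w.2 + w.1 • v.2)).add
    ((h3.clm_apply (hasFDerivAt_const v.2 p)).clm_apply (hasFDerivAt_const w.2 p))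
  have h6 := (h4.prodMk h5).fderiv
  refine (congrArg (fun f ↦ f u) h6).trans (Prod.ext ?_ ?_)
  · simp
    ring
  · simp [mul_comm]

/-- The curvature of `b(t)² (-dt² + h)`. -/
theorem coordRiemann_warped (hp : p ∈ J ×ˢ s) (u v w : ℝ × E) :
    coordRiemann (warped b h) p u v w =
      (deriv (fun t ↦ deriv b t / b t) p.1 * (u.1 * h p.2 v.2 w.2 - v.1 * h p.2 u.2 w.2),
        (deriv (fun t ↦ deriv b t / b t) p.1 * w.1) • (u.1 • v.2 - v.1 • u.2)
          + (deriv b p.1 / b p.1) ^ 2 • (h p.2 v.2 w.2 • u.2 - h p.2 u.2 w.2 • v.2)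
          + coordRiemann h p.2 u.2 v.2 w.2) := by
  have hsymm := H.symm _ hp.2
  have hk (x v w : E) : h p.2 x (christoffel h p.2 v w) = koszul h p.2 v w x := by
    rw [hsymm, apply_christoffel (H.isInvertible _ hp.2)]
  have hds (x v w : E) : fderiv ℝ h p.2 x v w = fderiv ℝ h p.2 x w v := by
    have hd := H.differentiableAt_right hp
    rw [fderiv_clm_apply₂ hd, fderiv_clm_apply₂ hd]
    congr 1
    apply Filter.EventuallyEq.fderiv_eq
    filter_upwards [H.isOpen_right.mem_nhds hp.2] with q hq
    exact H.symm q hq v w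
  have hcs : christoffel h p.2 u.2 v.2 = christoffel h p.2 v.2 u.2 := by
    refine christoffel_eq_of_koszul (H.isInvertible _ hp.2) fun z ↦ ?_
    rw [apply_christoffel (H.isInvertible _ hp.2), koszul_apply, koszul_apply,
      hds z u.2 v.2]
    ring
  rw [coordRiemann, H.fderiv_christoffel_warped hp, H.fderiv_christoffel_warped hp,
    H.christoffel_warped hp, H.christoffel_warped hp, H.christoffel_warped hp,
    H.christoffel_warped hp]
  refine Prod.ext ?_ ?_
  -- The derivatives of h cancel against those in its Christoffel symbols, because h is parallel and
  -- the connection torsion-free; the a² terms are symmetric in u and v and cancel too.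
  · simp only [Prod.fst_add, Prod.fst_sub, map_add, map_smul, smul_eq_mul, hk, koszul_apply,
      hsymm v.2 u.2, hds _ w.2, hds w.2 v.2 u.2]
    ring
  · simp only [Prod.snd_add, Prod.snd_sub, map_add, map_smul, hcs, coordRiemann,
      hsymm v.2 u.2]
    module

end IsWarpedData

end Warped

/-! ### Ricci and scalar curvature in coordinates -/

section Trace

variable {E : Type*} [NormedAddCommGroup E] [NormedSpace ℝ E] [FiniteDimensional ℝ E]

/-- An endomorphism that is skew for a nondegenerate symmetric bilinear form is traceless. -/
theorem trace_eq_zero_of_skew {B : E →L[ℝ] E →L[ℝ] ℝ} (hB : B.IsInvertible)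
    (hsymm : ∀ v w, B v w = B w v) {C : E →ₗ[ℝ] E} (hC : ∀ u, B (C u) u = 0) :
    LinearMap.trace ℝ E C = 0 := by
  have hskew (u w : E) : B (C w) u = -B (C u) w := by
    have := hC (u + w)
    simp only [map_add, add_apply, hC] at this
    linarith
  obtain ⟨e, rfl⟩ := hB
  -- Conjugation by the isomorphism that B induces turns C into minus its transpose, so tr C = -tr
  -- C.
  let f : E ≃ₗ[ℝ] Module.Dual ℝ E :=
    e.toLinearEquiv ≪≫ₗ (LinearMap.toContinuousLinearMap (𝕜 := ℝ) (E := E) (F' := ℝ)).symm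
  have hf (v w : E) : f v w = e v w := rfl
  have h : f.conj C = -Module.Dual.transpose (R := ℝ) C := by
    refine LinearMap.ext fun φ ↦ LinearMap.ext fun w ↦ ?_
    obtain ⟨v, rfl⟩ := f.surjective φ
    have h1 : f.conj C (f v) = f (C v) := by simp [LinearEquiv.conj_apply]
    rw [h1, hf]
    change e (C v) w = -(f v (C w))
    rw [hf]
    have h2 := hskew w v
    have h3 := hsymm v (C w)
    simp only [ContinuousLinearEquiv.coe_coe] at h2 h3
    rw [h2, h3]
  have ht := LinearMap.trace_conj' C f
  rw [h, map_neg, LinearMap.trace_transpose'] at ht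
  linarith

theorem trace_prod (T : ℝ × E →ₗ[ℝ] ℝ × E) :
    LinearMap.trace ℝ (ℝ × E) T = (T (1, 0)).1
      + LinearMap.trace ℝ E (LinearMap.snd ℝ ℝ E ∘ₗ T ∘ₗ LinearMap.inr ℝ ℝ E) := by
  have h : T = (T ∘ₗ LinearMap.inl ℝ ℝ E) ∘ₗ LinearMap.fst ℝ ℝ E
      + (T ∘ₗ LinearMap.inr ℝ ℝ E) ∘ₗ LinearMap.snd ℝ ℝ E := by
    ext <;> simp [← Prod.zero_eq_mk]
  have h1 : LinearMap.trace ℝ ℝ (LinearMap.fst ℝ ℝ E ∘ₗ T ∘ₗ LinearMap.inl ℝ ℝ E)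
      = (T (1, 0)).1 := by
    rw [LinearMap.trace_eq_matrix_trace ℝ (Module.Basis.singleton Unit ℝ)]
    simp [Matrix.trace, LinearMap.toMatrix_apply]
  conv_lhs => rw [h]
  rw [map_add, LinearMap.trace_comp_comm', LinearMap.trace_comp_comm' _ (LinearMap.snd ℝ ℝ E), h1]

theorem coordScalar_eq_trace {G : E → E →L[ℝ] E →L[ℝ] ℝ} {y : E} (hG : (G y).IsInvertible)
    {S : E →ₗ[ℝ] E} (hS : ∀ v w, G y (S v) w = coordRicci G y v w) :
    coordScalar G y = LinearMap.trace ℝ E S := by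
  rw [coordScalar]
  congr 1
  refine LinearMap.ext fun v ↦ ?_
  refine hG.inverse_apply_eq.2 ?_
  ext w
  exact (hS v w).symm

end Trace

/-! ### Ricci curvature of warped metrics and the pointwise Friedmann equations -/

section RicciWarped

variable {E : Type*} [NormedAddCommGroup E] [NormedSpace ℝ E] [FiniteDimensional ℝ E]
  {b : ℝ → ℝ} {h : E → E →L[ℝ] E →L[ℝ] ℝ} {J : Set ℝ} {s : Set E} {p : ℝ × E}

/-- In constant curvature `K`, the quadratic form of the Ricci curvature is `(n - 1) K` times the
metric. -/
theorem coordRicci_self {y : E} (hinv : (h y).IsInvertible) (hsymm : ∀ v w, h y v w = h y w v)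
    {K : ℝ} (hK : ∀ v w, LinearIndependent ℝ ![v, w] →
      h y (coordRiemann h y v w w) v = K * (h y v v * h y w w - h y v w ^ 2)) (v : E) :
    coordRicci h y v v = (Module.finrank ℝ E - 1) * K * h y v v := by
  -- B is the value of R(·,v)v in a space form. The hypothesis only says that the difference has
  -- zero quadratic form; that makes it skew, hence traceless, so no symmetry of the curvature
  -- tensor is needed.
  let B : E →ₗ[ℝ] E := (K * h y v v) • LinearMap.id
    - K • ((h y v : E →ₗ[ℝ] ℝ).smulRight v)
  have hB : LinearMap.trace ℝ E (coordRiemannEnd h y v v - B) = 0 := by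
    refine trace_eq_zero_of_skew hinv hsymm fun u ↦ ?_
    have hBu : B u = (K * h y v v) • u - K • h y v u • v := rfl
    have hRu : coordRiemannEnd h y v v u = coordRiemann h y u v v := rfl
    rw [LinearMap.sub_apply, hBu, hRu]
    simp only [map_sub, map_smul, sub_apply, smul_apply, smul_eq_mul]
    by_cases hi : LinearIndependent ℝ ![u, v]
    · rw [hK u v hi, hsymm v u]
      ring
    · obtain rfl | hv := eq_or_ne v 0
      · simp [coordRiemann]
      · obtain ⟨a, rfl⟩ : ∃ a : ℝ, a • v = u := by
          by_contra! hne
          refine hi (LinearIndependent.pair_symm_iff.1 ?_)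
          exact (LinearIndependent.pair_iff' hv).2 hne
        simp [coordRiemann]
        ring
  have hBt : LinearMap.trace ℝ E B = (Module.finrank ℝ E - 1) * K * h y v v := by
    simp only [B, map_sub, map_smul, LinearMap.trace_id, LinearMap.trace_smulRight, smul_eq_mul,
      ContinuousLinearMap.coe_coe]
    ring
  rw [map_sub, hBt] at hB
  exact sub_eq_zero.1 hB

namespace IsWarpedData

variable (H : IsWarpedData b h J s)
include H

theorem coordRicci_warped (hp : p ∈ J ×ˢ s) (v w : ℝ × E) :
    coordRicci (warped b h) p v w =
      deriv (fun t ↦ deriv b t / b t) p.1 * (h p.2 v.2 w.2 - Module.finrank ℝ E * (v.1 * w.1))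
        + (deriv b p.1 / b p.1) ^ 2 * ((Module.finrank ℝ E - 1) * h p.2 v.2 w.2)
        + coordRicci h p.2 v.2 w.2 := by
  have h0 : coordRicci (warped b h) p v w =
    LinearMap.trace ℝ (ℝ × E) (coordRiemannEnd (warped b h) p v w) := rfl
  have h1 (u : ℝ × E) : coordRiemannEnd (warped b h) p v w u = _ := H.coordRiemann_warped hp u v w
  set a' := deriv (fun t ↦ deriv b t / b t) p.1
  set a := deriv b p.1 / b p.1
  have h2 : LinearMap.snd ℝ ℝ E ∘ₗ coordRiemannEnd (warped b h) p v w ∘ₗ LinearMap.inr ℝ ℝ E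
      = (a ^ 2 * h p.2 v.2 w.2 - a' * w.1 * v.1) • LinearMap.id
        - a ^ 2 • ((h p.2 w.2 : E →ₗ[ℝ] ℝ).smulRight v.2) + coordRiemannEnd h p.2 v.2 w.2 := by
    refine LinearMap.ext fun u ↦ ?_
    simp only [LinearMap.comp_apply, h1, LinearMap.snd_apply, LinearMap.inr_apply,
      LinearMap.add_apply, LinearMap.sub_apply, LinearMap.smul_apply, LinearMap.id_apply,
      LinearMap.smulRight_apply, ContinuousLinearMap.coe_coe, H.symm _ hp.2 w.2 u]
    change _ = _ + coordRiemann h p.2 u v.2 w.2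
    module
  have h3 : coordRicci h p.2 v.2 w.2 =
    LinearMap.trace ℝ E (coordRiemannEnd h p.2 v.2 w.2) := rfl
  rw [h0, trace_prod, h1, h2, h3]
  simp only [map_add, map_sub, map_smul, LinearMap.trace_id, LinearMap.trace_smulRight,
    smul_eq_mul, ContinuousLinearMap.coe_coe, H.symm _ hp.2 w.2 v.2, map_zero, zero_apply]
  ring

theorem coordScalar_warped (hp : p ∈ J ×ˢ s) {α β : ℝ}
    (hR : ∀ v w, coordRicci (warped b h) p v w = α * (v.1 * w.1) + β * h p.2 v.2 w.2) :
    coordScalar (warped b h) p = (Module.finrank ℝ E * β - α) / b p.1 ^ 2 := by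
  have hb := H.ne_zero _ hp.1
  rw [coordScalar_eq_trace (H.isInvertible_prod hp)
    -- The Ricci endomorphism; -α reflects the negative sign of dt² in the metric.
    (S := ((b p.1 ^ 2)⁻¹ • LinearMap.prodMap ((-α) • LinearMap.id) (β • LinearMap.id)))]
  · rw [map_smul, LinearMap.trace_prodMap']
    simp
    ring
  · intro v w
    rw [hR, LinearMap.smul_apply, map_smul, smul_apply, warped_apply]
    simp
    field_simp

/-- The Einstein equation with dust for `b(t)² (-dt² + h)`, if the quadratic form of the Ricci
curvature of `h` is `2 K h` at the given point. -/
theorem friedmann (hp : p ∈ J ×ˢ s) (hdim : Module.finrank ℝ E = 3)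
    (hpos : ∀ v, v ≠ 0 → 0 < h p.2 v v) {K Λ ρ : ℝ}
    (hK : ∀ v, coordRicci h p.2 v v = 2 * K * h p.2 v v) {u : ℝ × E}
    (hu : warped b h p u u = -1)
    (hE : ∀ v w, coordRicci (warped b h) p v w
        - 1 / 2 * coordScalar (warped b h) p * warped b h p v w
      = 8 * Real.pi * (ρ * warped b h p u v * warped b h p u w) - Λ * warped b h p v w) :
    3 * ((deriv b p.1 / b p.1) ^ 2 + K) - Λ * b p.1 ^ 2 = 8 * Real.pi * ρ * b p.1 ^ 2 ∧
      2 * deriv (fun t ↦ deriv b t / b t) p.1 + (deriv b p.1 / b p.1) ^ 2 + K = Λ * b p.1 ^ 2 := by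
  have hsymm := H.symm _ hp.2
  have hb := H.ne_zero _ hp.1
  have hR := H.coordRicci_warped hp
  set a' := deriv (fun t ↦ deriv b t / b t) p.1
  set a := deriv b p.1 / b p.1
  set β := b p.1
  -- Every other term of Einstein's equation is symmetric, so the symmetry of Ric(h) comes for free
  -- and allows polarization.
  have hRs (v w : E) : coordRicci h p.2 v w = coordRicci h p.2 w v := by
    have h1 := hE (0, v) (0, w)
    have h2 := hE (0, w) (0, v)
    rw [hR] at h1 h2
    simp only [warped_apply, hsymm w v] at h1 h2
    linarith
  have hRK (v w : E) : coordRicci h p.2 v w = 2 * K * h p.2 v w := by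
    have h1 := hK (v + w)
    simp only [map_add, add_apply, LinearMap.add_apply, hK, hsymm w v, hRs w v] at h1
    linarith
  have hRic (v w : ℝ × E) : coordRicci (warped b h) p v w =
      (-3 * a') * (v.1 * w.1) + (a' + 2 * a ^ 2 + 2 * K) * h p.2 v.2 w.2 := by
    rw [hR, hRK, hdim]
    push_cast
    ring
  have hS : coordScalar (warped b h) p * β ^ 2 = 6 * (a' + a ^ 2 + K) := by
    rw [H.coordScalar_warped hp hRic, hdim, div_mul_cancel₀ _ (pow_ne_zero 2 hb)]
    push_cast
    ring
  have key (v : ℝ × E) : (3 * (a ^ 2 + K) - Λ * β ^ 2) * v.1 ^ 2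
      - (2 * a' + a ^ 2 + K - Λ * β ^ 2) * h p.2 v.2 v.2
        = 8 * Real.pi * ρ * β ^ 4 * (-(u.1 * v.1) + h p.2 u.2 v.2) ^ 2 := by
    have h1 := hE v v
    rw [hRic] at h1
    simp only [warped_apply] at h1
    linear_combination h1 + 1 / 2 * (-(v.1 * v.1) + h p.2 v.2 v.2) * hS
  rw [warped_apply] at hu
  -- A linear form on a 3-dimensional space has a nonzero kernel vector; testing on it removes the
  -- matter term.
  obtain ⟨v, hv, hv0⟩ : ∃ v, h p.2 u.2 v = 0 ∧ v ≠ 0 := by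
    by_contra! hne
    have hinj : Function.Injective (h p.2 u.2 : E →ₗ[ℝ] ℝ) :=
      (injective_iff_map_eq_zero _).2 hne
    have := LinearMap.finrank_le_finrank_of_injective hinj
    simp [hdim] at this
  have hB : 2 * a' + a ^ 2 + K - Λ * β ^ 2 = 0 := by
    have h1 := key (0, v)
    simp only [hv] at h1
    have h2 := (hpos v hv0).ne'
    have h3 : (2 * a' + a ^ 2 + K - Λ * β ^ 2) * h p.2 v v = 0 := by linear_combination -h1
    exact (mul_eq_zero.1 h3).resolve_right h2
  have hρ : ρ * h p.2 u.2 u.2 = 0 := by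
    by_cases hu2 : u.2 = 0
    · simp [hu2]
    have h1 := key (0, u.2)
    have h3 : ρ * h p.2 u.2 u.2 * (8 * Real.pi * β ^ 4 * h p.2 u.2 u.2) = 0 := by
      simp only at h1
      linear_combination -h1 - h p.2 u.2 u.2 * hB
    have h4 : 8 * Real.pi * β ^ 4 * h p.2 u.2 u.2 ≠ 0 :=
      mul_ne_zero (by positivity) (hpos _ hu2).ne'
    exact (mul_eq_zero.1 h3).resolve_right h4
  refine ⟨?_, by linarith⟩
  -- The normalization of u, with ρ h(u,u) = 0, turns ρ b⁴ u₀² into ρ b².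
  have h1 := key (1, 0)
  simp only [map_zero] at h1
  linear_combination h1 - 8 * Real.pi * ρ * β ^ 2 * hu + 8 * Real.pi * β ^ 4 * hρ

end IsWarpedData

end RicciWarped

/-! ### Charts -/

section Charts

variable {E : Type*} [NormedAddCommGroup E] [NormedSpace ℝ E]
  {H : Type*} [TopologicalSpace H] {I : ModelWithCorners ℝ E H}
  {M : Type*} [TopologicalSpace M] [ChartedSpace H M] [IsManifold I ∞ M]

theorem chartDeriv_bijective (p : M) : Function.Bijective (chartDeriv I p) := by
  have : IsManifold I 1 M := .of_le (n := ∞) (by simp)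
  obtain ⟨e, he⟩ := isInvertible_mfderiv_extChartAt (I := I) (mem_extChartAt_source (I := I) p)
  rw [chartDeriv, ← he]
  exact e.bijective

theorem chartExpr_symm
    (g : Bundle.ContMDiffRiemannianMetric I ∞ E (fun x : M ↦ TangentSpace I x)) (p : M)
    (y v w : E) :
    chartExpr I g.inner p y v w = chartExpr I g.inner p y w v := by
  rw [chartExpr_apply, chartExpr_apply, g.symm]

variable [I.Boundaryless]

theorem mdifferentiableAt_extChartAt_symm {p : M} {y : E} (hy : y ∈ (extChartAt I p).target) :
    MDifferentiableAt 𝓘(ℝ, E) I (extChartAt I p).symm y := by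
  have : IsManifold I 1 M := .of_le (n := ∞) (by simp)
  have h := mdifferentiableWithinAt_extChartAt_symm hy
  rwa [I.range_eq_univ, mdifferentiableWithinAt_univ] at h

theorem isInvertible_mfderiv_extChartAt_symm {p : M} {y : E}
    (hy : y ∈ (extChartAt I p).target) :
    (mfderiv 𝓘(ℝ, E) I (extChartAt I p).symm y).IsInvertible := by
  have : IsManifold I 1 M := .of_le (n := ∞) (by simp)
  have h := isInvertible_mfderivWithin_extChartAt_symm hy
  rwa [I.range_eq_univ, mfderivWithin_univ] at h

theorem mfderiv_symm_chartDeriv (p : M) (v : TangentSpace I p) :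
    (mfderiv 𝓘(ℝ, E) I (extChartAt I p).symm (extChartAt I p p) (chartDeriv I p v) : E) = v := by
  have : IsManifold I 1 M := .of_le (n := ∞) (by simp)
  have h := mfderivWithin_extChartAt_symm_comp_mfderiv_extChartAt' (I := I)
    (mem_extChartAt_source (I := I) p)
  rw [I.range_eq_univ, mfderivWithin_univ] at h
  exact congrArg (fun f ↦ f v) h

theorem chartExpr_chartDeriv (g : BilinField I M) (p : M) (v w : TangentSpace I p) :
    chartExpr I g p (extChartAt I p p) (chartDeriv I p v) (chartDeriv I p w) = g p v w := by
  rw [chartExpr_apply]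
  have hv := mfderiv_symm_chartDeriv p v
  have hw := mfderiv_symm_chartDeriv p w
  -- The base points agree only propositionally, so the equality is generalized over q, all tangent
  -- spaces being E by definition.
  have h : ∀ q (hq : q = p) (v' w' : E), v' = v → w' = w →
      (g q : E →L[ℝ] E →L[ℝ] ℝ) v' w' = g p v w := by
    rintro q rfl _ _ rfl rfl
    rfl
  exact h _ (extChartAt_to_inv p) _ _ hv hw

/-- Coordinate vector fields are smooth, being images of constant fields under the tangent map of
the inverse chart; the metric components are g evaluated on them. -/
theorem contMDiffOn_mfderiv_extChartAt_symm (p : M) (v : E) :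
    ContMDiffOn 𝓘(ℝ, E) I.tangent ∞
      (fun y ↦ (⟨(extChartAt I p).symm y, mfderiv 𝓘(ℝ, E) I (extChartAt I p).symm y v⟩ :
        TangentBundle I M)) (extChartAt I p).target := by
  have hopen : IsOpen (extChartAt I p).target := isOpen_extChartAt_target p
  have h := (contMDiffOn_extChartAt_symm (I := I) (n := ∞) p).contMDiffOn_tangentMapWithin
    (m := ∞) (by simp) hopen.uniqueMDiffOn
  have hv : ContMDiffOn 𝓘(ℝ, E) 𝓘(ℝ, E).tangent ∞
      (fun y ↦ (⟨y, v⟩ : TangentBundle 𝓘(ℝ, E) E)) (extChartAt I p).target :=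
    contMDiffOn_vectorSpace_iff_contDiffOn.2 contDiffOn_const
  refine (h.comp hv fun y hy ↦ hy).congr fun y hy ↦ ?_
  exact congrArg (fun f : E →L[ℝ] TangentSpace I ((extChartAt I p).symm y) ↦
      (⟨(extChartAt I p).symm y, f v⟩ : TangentBundle I M))
    (mfderivWithin_of_isOpen (I := 𝓘(ℝ, E)) (I' := I) (f := (extChartAt I p).symm) hopen hy).symm

variable (g : Bundle.ContMDiffRiemannianMetric I ∞ E (fun x : M ↦ TangentSpace I x))

theorem contDiffOn_chartExpr [FiniteDimensional ℝ E] (p : M) :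
    ContDiffOn ℝ ∞ (chartExpr I g.inner p) (extChartAt I p).target := by
  refine contDiffOn_clm_apply₂ fun v w ↦ ?_
  have hg : ContMDiffOn 𝓘(ℝ, E) (I.prod 𝓘(ℝ, E →L[ℝ] E →L[ℝ] ℝ)) ∞
      (fun y ↦ Bundle.TotalSpace.mk' (E →L[ℝ] E →L[ℝ] ℝ)
        (E := fun x : M ↦ TangentSpace I x →L[ℝ] TangentSpace I x →L[ℝ] ℝ)
        ((extChartAt I p).symm y) (g.inner ((extChartAt I p).symm y))) (extChartAt I p).target :=
    g.contMDiff.comp_contMDiffOn (contMDiffOn_extChartAt_symm p)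
  have h := ContMDiffOn.clm_bundle_apply₂ (E₃ := Bundle.Trivial M ℝ) hg
    (contMDiffOn_mfderiv_extChartAt_symm p v) (contMDiffOn_mfderiv_extChartAt_symm p w)
  intro y hy
  have h' := (Bundle.contMDiffWithinAt_totalSpace.1 (h y hy)).2
  exact contMDiffWithinAt_iff_contDiffWithinAt.1 h'

theorem chartExpr_pos {p : M} {y : E} (hy : y ∈ (extChartAt I p).target) {v : E} (hv : v ≠ 0) :
    0 < chartExpr I g.inner p y v v := by
  rw [chartExpr_apply]
  refine g.pos _ _ fun h0 ↦ hv ?_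
  obtain ⟨e, he⟩ := isInvertible_mfderiv_extChartAt_symm hy
  rw [← he] at h0
  exact e.map_eq_zero_iff.1 h0

theorem isInvertible_chartExpr [FiniteDimensional ℝ E] {p : M} {y : E}
    (hy : y ∈ (extChartAt I p).target) : (chartExpr I g.inner p y).IsInvertible := by
  refine isInvertible_of_injective ((injective_iff_map_eq_zero _).2 fun v hv ↦ ?_)
  by_contra h0
  have := chartExpr_pos g hy h0
  simp [hv] at this

/-- Constant sectional curvature in the chart at `p`. -/
theorem chartExpr_coordRiemann {K : ℝ} (hK : HasConstantSectionalCurvature I g.inner K) (p : M)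
    {v w : E} (hvw : LinearIndependent ℝ ![v, w]) :
    chartExpr I g.inner p (extChartAt I p p)
        (coordRiemann (chartExpr I g.inner p) (extChartAt I p p) v w w) v =
      K * (chartExpr I g.inner p (extChartAt I p p) v v
          * chartExpr I g.inner p (extChartAt I p p) w w
        - chartExpr I g.inner p (extChartAt I p p) v w ^ 2) := by
  obtain ⟨v, rfl⟩ := (chartDeriv_bijective (I := I) p).2 v
  obtain ⟨w, rfl⟩ := (chartDeriv_bijective (I := I) p).2 w
  have hli : LinearIndependent ℝ ![v, w] := by
    refine LinearIndependent.of_comp (chartDeriv I p : TangentSpace I p →ₗ[ℝ] E) ?_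
    convert hvw using 1
    ext i
    fin_cases i <;> rfl
  have hne : g.inner p v v * g.inner p w w - g.inner p v w ^ 2 ≠ 0 := by
    have hv : v ≠ 0 := hli.ne_zero 0
    have hvv := g.pos p v hv
    -- The squared length of this vector is g(v,v) times the Gram determinant, which is therefore
    -- positive.
    have hx : g.inner p v v • w - g.inner p v w • v ≠ 0 := by
      intro h0
      have := (LinearIndependent.pair_iff.1 hli (-g.inner p v w) (g.inner p v v) (by
        rw [← h0]; module)).2
      exact hvv.ne' this
    have hxx := g.pos p _ hx
    simp only [map_sub, map_smul, sub_apply, smul_apply, smul_eq_mul, g.symm p w v] at hxx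
    intro h0
    have h1 : g.inner p v v * (g.inner p v v * g.inner p w w - g.inner p v w ^ 2) > 0 := by
      linarith
    simp [h0] at h1
  have h := hK p v w hli
  rw [sectionalCurvature, div_eq_iff hne] at h
  simp only [chartExpr_chartDeriv]
  exact h

end Charts

/-! ### Robertson–Walker metrics in product charts -/

section RobertsonWalkerChart

variable {V : Type*} [TopologicalSpace V] [ChartedSpace E3 V]

theorem extChartAt_I4_symm_apply (p : ℝ × V) (y : ℝ × E3) :
    (extChartAt I4 p).symm y = (y.1, (extChartAt (𝓡 3) p.2).symm y.2) := by
  rw [extChartAt_prod]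
  rfl

theorem mem_extChartAt_I4_target {p : ℝ × V} {y : ℝ × E3} :
    y ∈ (extChartAt I4 p).target ↔ y.2 ∈ (extChartAt (𝓡 3) p.2).target := by
  rw [extChartAt_prod, PartialEquiv.prod_target, Set.mem_prod]
  exact and_iff_right (by simp only [mfld_simps, chartAt_self_eq])

theorem extChartAt_I4_self (p : ℝ × V) :
    extChartAt I4 p p = (p.1, extChartAt (𝓡 3) p.2 p.2) := by
  rw [extChartAt_prod]
  rfl

/-- The expression of a Robertson-Walker metric in a product chart. -/
theorem chartExpr_rwMetric [IsManifold (𝓡 3) ∞ V] (gbar : BilinField (𝓡 3) V) (b : ℝ → ℝ)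
    {p : ℝ × V} {y : ℝ × E3}
    (hy : y.2 ∈ (extChartAt (𝓡 3) p.2).target) :
    chartExpr I4 (rwMetric gbar b) p y = warped b (chartExpr (𝓡 3) gbar p.2) y := by
  have hd := mdifferentiableAt_extChartAt_symm (I := I4) (mem_extChartAt_I4_target.2 hy)
  have hd2 := mdifferentiableAt_extChartAt_symm (I := 𝓡 3) hy
  -- The inverse product chart commutes with both projections; the chain rule does the rest.
  have hs (v : ℝ × E3) : ds ((extChartAt I4 p).symm y)
      (mfderiv 𝓘(ℝ, ℝ × E3) I4 (extChartAt I4 p).symm y v) = v.1 := by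
    have h := mfderiv_comp_apply y
      (mdifferentiableAt_fst (I := 𝓘(ℝ, ℝ)) (I' := 𝓡 3) (x := (extChartAt I4 p).symm y)) hd v
    have h' : (Prod.fst : ℝ × V → ℝ) ∘ (extChartAt I4 p).symm = Prod.fst := by
      funext z
      rw [Function.comp_apply, extChartAt_I4_symm_apply]
    rw [h', mfderiv_eq_fderiv, fderiv_fst] at h
    exact h.symm
  have hp (v : ℝ × E3) : (dproj ((extChartAt I4 p).symm y)
      (mfderiv 𝓘(ℝ, ℝ × E3) I4 (extChartAt I4 p).symm y v) : E3) =
        mfderiv 𝓘(ℝ, E3) (𝓡 3) (extChartAt (𝓡 3) p.2).symm y.2 v.2 := by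
    have h := mfderiv_comp_apply y
      (mdifferentiableAt_snd (I := 𝓘(ℝ, ℝ)) (I' := 𝓡 3) (x := (extChartAt I4 p).symm y)) hd v
    have h' : (Prod.snd : ℝ × V → V) ∘ (extChartAt I4 p).symm
        = (extChartAt (𝓡 3) p.2).symm ∘ Prod.snd := by
      funext z
      rw [Function.comp_apply, extChartAt_I4_symm_apply]
      rfl
    have h2 := mfderiv_comp_apply (I := 𝓘(ℝ, ℝ × E3)) (f := (Prod.snd : ℝ × E3 → E3)) y hd2
      differentiableAt_snd.mdifferentiableAt v
    rw [h', h2, mfderiv_eq_fderiv, fderiv_snd] at h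
    exact h.symm
  refine ContinuousLinearMap.ext fun v ↦ ContinuousLinearMap.ext fun w ↦ ?_
  rw [chartExpr_apply, rwMetric_apply, warped_apply, chartExpr_apply, hs, hs]
  have hg : ∀ q q' (_ : q = q') (v' w' : E3), (gbar q : E3 →L[ℝ] E3 →L[ℝ] ℝ) v' w' =
      (gbar q' : E3 →L[ℝ] E3 →L[ℝ] ℝ) v' w' := by
    rintro q _ rfl v' w'
    rfl
  have hq := extChartAt_I4_symm_apply p y
  have h := hg _ _ (congrArg Prod.snd hq)
    (mfderiv 𝓘(ℝ, E3) (𝓡 3) (extChartAt (𝓡 3) p.2).symm y.2 v.2)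
    (mfderiv 𝓘(ℝ, E3) (𝓡 3) (extChartAt (𝓡 3) p.2).symm y.2 w.2)
  rw [← hp v, ← hp w] at h
  have hb : b ((extChartAt I4 p).symm y).1 = b y.1 := by rw [hq]
  rw [hb]
  congr 2
  refine h.trans ?_
  rw [hp v, hp w]

end RobertsonWalkerChart

/-! ### Friedmann equations of a Robertson-Walker space-time filled with dust -/

section Friedmann

variable {V : Type*} [TopologicalSpace V] [ChartedSpace E3 V] [IsManifold (𝓡 3) ∞ V]

theorem isWarpedData_chartExpr
    (gbar : Bundle.ContMDiffRiemannianMetric (𝓡 3) ∞ E3 (fun x : V ↦ TangentSpace (𝓡 3) x))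
    {J : Set ℝ} (hJ : IsOpen J) {b : ℝ → ℝ} (hb : ContDiffOn ℝ ∞ b J)
    (hb_pos : ∀ s ∈ J, 0 < b s) (x : V) :
    IsWarpedData b (chartExpr (𝓡 3) gbar.inner x) J (extChartAt (𝓡 3) x).target where
  isOpen_left := hJ
  isOpen_right := isOpen_extChartAt_target x
  contDiffOn_left := hb
  contDiffOn_right := contDiffOn_chartExpr gbar x
  ne_zero t ht := (hb_pos t ht).ne'
  symm y _ := chartExpr_symm gbar x y
  isInvertible _ hy := isInvertible_chartExpr gbar hy

theorem friedmann_of_einstein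
    (gbar : Bundle.ContMDiffRiemannianMetric (𝓡 3) ∞ E3 (fun x : V ↦ TangentSpace (𝓡 3) x))
    {K : ℝ} (hK : HasConstantSectionalCurvature (𝓡 3) gbar.inner K)
    {J : Set ℝ} (hJ : IsOpen J) {b : ℝ → ℝ} (hb : ContDiffOn ℝ ∞ b J)
    (hb_pos : ∀ s ∈ J, 0 < b s) {Λ : ℝ} {ρ : ℝ × V → ℝ} {u : Π p : ℝ × V, TangentSpace I4 p}
    {p : ℝ × V} (hp : p.1 ∈ J) (hu : rwMetric gbar.inner b p (u p) (u p) = -1)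
    (hE : EinsteinEquationAt I4 (rwMetric gbar.inner b) Λ
      (dustTensor I4 (rwMetric gbar.inner b) ρ u) p) :
    3 * ((deriv b p.1 / b p.1) ^ 2 + K) - Λ * b p.1 ^ 2 = 8 * Real.pi * ρ p * b p.1 ^ 2 ∧
      2 * deriv (fun t ↦ deriv b t / b t) p.1 + (deriv b p.1 / b p.1) ^ 2 + K = Λ * b p.1 ^ 2 := by
  have H := isWarpedData_chartExpr gbar hJ hb hb_pos p.2
  have hmem : extChartAt I4 p p ∈ J ×ˢ (extChartAt (𝓡 3) p.2).target := by
    rw [extChartAt_I4_self]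
    exact ⟨hp, mem_extChartAt_target p.2⟩
  have heq : chartExpr I4 (rwMetric gbar.inner b) p =ᶠ[nhds (extChartAt I4 p p)]
      warped b (chartExpr (𝓡 3) gbar.inner p.2) := by
    filter_upwards [H.isOpen_prod.mem_nhds hmem] with y hy
    exact chartExpr_rwMetric gbar.inner b hy.2
  have hg (v w : TangentSpace I4 p) : rwMetric gbar.inner b p v w =
      warped b (chartExpr (𝓡 3) gbar.inner p.2) (extChartAt I4 p p)
        (chartDeriv I4 p v) (chartDeriv I4 p w) := by
    rw [← heq.eq_of_nhds, chartExpr_chartDeriv]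
  have hpt : (extChartAt I4 p p).1 = p.1 := by rw [extChartAt_I4_self]
  have hpt2 : (extChartAt I4 p p).2 = extChartAt (𝓡 3) p.2 p.2 := by rw [extChartAt_I4_self]
  have h := H.friedmann hmem (K := K) (Λ := Λ) (ρ := ρ p) (u := chartDeriv I4 p (u p)) (by simp)
    (fun v hv ↦ chartExpr_pos gbar hmem.2 hv) (fun v ↦ ?_) (by rw [← hg, hu]) (fun v w ↦ ?_)
  · rwa [hpt] at h
  · rw [hpt2, coordRicci_self (isInvertible_chartExpr gbar (mem_extChartAt_target p.2))
      (chartExpr_symm gbar p.2 _) fun v w ↦ chartExpr_coordRiemann gbar hK p.2]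
    norm_num
  · obtain ⟨v, rfl⟩ := (chartDeriv_bijective (I := I4) p).2 v
    obtain ⟨w, rfl⟩ := (chartDeriv_bijective (I := I4) p).2 w
    have h := hE v w
    rw [ricci, scalarCurvature, dustTensor, coordRicci_congr heq, coordScalar_congr heq,
      hg, hg, hg] at h
    exact h

/-- The acceleration equation says that the energy density of dust is inversely proportional to
`b³`. -/
theorem exists_const_of_acceleration {J : Set ℝ} (hJ : IsOpen J) (hJ' : J.OrdConnected)
    {b : ℝ → ℝ} (hb : ContDiffOn ℝ ∞ b J) (hb_pos : ∀ s ∈ J, 0 < b s) {K Λ : ℝ}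
    (h : ∀ s ∈ J, 2 * deriv (fun t ↦ deriv b t / b t) s + (deriv b s / b s) ^ 2 + K
      = Λ * b s ^ 2) :
    ∃ c : ℝ, ∀ s ∈ J,
      deriv (deriv b) s + K * b s - 2 / 3 * Λ * b s ^ 3 = 4 / 3 * Real.pi * c ∧
      3 * deriv b s ^ 2 * (b s)⁻¹ + 3 * K * b s - Λ * b s ^ 3 = 8 * Real.pi * c := by
  have h1 (s) (hs : s ∈ J) : HasDerivAt b (deriv b s) s :=
    ((hb.contDiffAt (hJ.mem_nhds hs)).differentiableAt (by simp)).hasDerivAt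
  have h2 (s) (hs : s ∈ J) : HasDerivAt (deriv b) (deriv (deriv b) s) s :=
    (((hb.deriv_of_isOpen hJ (m := ∞) (by simp)).contDiffAt
      (hJ.mem_nhds hs)).differentiableAt (by simp)).hasDerivAt
  have h3 (s) (hs : s ∈ J) :
      2 * deriv (deriv b) s * b s - deriv b s ^ 2 + K * b s ^ 2 = Λ * b s ^ 4 := by
    have hne := (hb_pos s hs).ne'
    have := h s hs
    have hd := ((h2 s hs).div (h1 s hs) hne).deriv
    simp only [Pi.div_def] at hd
    rw [hd] at this
    field_simp at this
    linear_combination this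
  -- F' is 3b'/b² times the difference of the two sides of `h3`.
  let F : ℝ → ℝ := fun s ↦ 3 * deriv b s ^ 2 * (b s)⁻¹ + 3 * K * b s - Λ * b s ^ 3
  have hF (s) (hs : s ∈ J) : HasDerivAt F 0 s := by
    have hne := (hb_pos s hs).ne'
    have := (((((h2 s hs).pow 2).const_mul 3).mul ((h1 s hs).inv hne)).add
      ((h1 s hs).const_mul (3 * K))).sub (((h1 s hs).pow 3).const_mul Λ)
    refine this.congr_deriv ?_
    simp only [Pi.pow_apply, Pi.inv_apply]
    field_simp
    push_cast
    linear_combination 3 * deriv b s * h3 s hs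
  have hconst (s) (hs : s ∈ J) (t) (ht : t ∈ J) : F s = F t :=
    hJ.is_const_of_deriv_eq_zero hJ'.isPreconnected
      (fun s hs ↦ (hF s hs).differentiableAt.differentiableWithinAt)
      (fun s hs ↦ (hF s hs).deriv) hs ht
  obtain rfl | ⟨s₀, hs₀⟩ := J.eq_empty_or_nonempty
  · exact ⟨0, by simp⟩
  refine ⟨F s₀ / (8 * Real.pi), fun s hs ↦ ?_⟩
  have hne := (hb_pos s hs).ne'
  have hpi := Real.pi_ne_zero
  rw [← hconst s hs s₀ hs₀]
  constructor
  · simp only [F]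
    field_simp
    -- Dividing `h3` by 2b and adding F/6 gives the second-order equation.
    linear_combination 12 * h3 s hs
  · simp only [F]
    field_simp

end Friedmann

end RobertsonWalker

theorem mainTheorem8 {V : Type*} [TopologicalSpace V]
    [ChartedSpace (EuclideanSpace ℝ (Fin 3)) V] [IsManifold (𝓡 3) ∞ V] [Nonempty V]
    (gbar : Bundle.ContMDiffRiemannianMetric (𝓡 3) ∞ (EuclideanSpace ℝ (Fin 3))
      (fun x : V ↦ TangentSpace (𝓡 3) x))
    (K : ℝ) (hK : RobertsonWalker.HasConstantSectionalCurvature (𝓡 3) gbar.inner K)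
    (J : Set ℝ) (hJ_open : IsOpen J) (hJ_interval : J.OrdConnected)
    (b : ℝ → ℝ) (hb_smooth : ContDiffOn ℝ ∞ b J) (hb_pos : ∀ s ∈ J, 0 < b s)
    (Λ : ℝ) (ρ : ℝ × V → ℝ)
    (u : Π p : ℝ × V, TangentSpace RobertsonWalker.I4 p)
    (hu : ∀ p : ℝ × V, p.1 ∈ J →
      RobertsonWalker.rwMetric gbar.inner b p (u p) (u p) = -1)
    (hEinstein : ∀ p : ℝ × V, p.1 ∈ J →
      RobertsonWalker.EinsteinEquationAt RobertsonWalker.I4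
        (RobertsonWalker.rwMetric gbar.inner b) Λ
        (RobertsonWalker.dustTensor RobertsonWalker.I4
          (RobertsonWalker.rwMetric gbar.inner b) ρ u) p) :
    ∃ c : ℝ, (∀ p : ℝ × V, p.1 ∈ J → ρ p = c / b p.1 ^ 3) ∧
      ∀ s ∈ J,
        deriv (deriv b) s + K * b s - 2 / 3 * Λ * b s ^ 3 = 4 / 3 * Real.pi * c ∧
        3 * deriv b s ^ 2 * (b s)⁻¹ + 3 * K * b s - Λ * b s ^ 3 = 8 * Real.pi * c := by
  have hF := fun p : ℝ × V ↦ fun hp : p.1 ∈ J ↦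
    RobertsonWalker.friedmann_of_einstein gbar hK hJ_open hb_smooth hb_pos hp (hu p hp)
      (hEinstein p hp)
  -- The acceleration equation does not involve x, so one point of V suffices.
  obtain ⟨x⟩ := ‹Nonempty V›
  obtain ⟨c, hc⟩ := RobertsonWalker.exists_const_of_acceleration hJ_open hJ_interval hb_smooth
    hb_pos fun s hs ↦ (hF (s, x) hs).2
  refine ⟨c, fun p hp ↦ ?_, hc⟩
  have hne := (hb_pos p.1 hp).ne'
  have hpi := Real.pi_ne_zero
  have h1 := (hF p hp).1
  have h2 := (hc p.1 hp).2
  rw [eq_div_iff (pow_ne_zero 3 hne)]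
  refine mul_left_cancel₀ (mul_ne_zero (by norm_num : (8 : ℝ) ≠ 0) hpi) ?_
  rw [← h2]
  field_simp at h1 ⊢
  linear_combination -h1
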